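/- All groups are additive abelian groups. A group $G$ is called *generalized co-Hopfian* if $\phi(G)$ is a direct summand of $G$ for every injective endomorphism $\phi:G\to G$, and *hereditarily generalized co-Hopfian* if every subgroup of $G$ is generalized co-Hopfian. A group is *elementary* if each of its elements has finite square-free order. A set of nonzero elements of a group is *independent* if $n_1g_1+\cdots+n_kg_k=0$, with distinct $g_i$ in the set and integers $n_i$, implies $n_ig_i=0$ for all $i$; the *rank* of a group is the cardinality of any maximal independent set of elements each of infinite or prime power order. **Proposition.** A group $G$ is hereditarily generalized co-Hopfian if, and only if, $G$ is a torsion group and there are subgroups $A,B,C$ of $G$ with $G=A\oplus B\oplus C$ such that $C$ is the divisible part (the largest divisible subgroup) of $G$ and for every prime $p$ the $p$-component of $C$ has finite rank; $B$ is an elementary group; $A$ has no nonzero elementary direct summand, and for every prime $p$ the $p$-component of $A$ is finite. -/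

import Mathlib

namespace HerGenCoHopf

/-- `G` is generalized co-Hopfian: the image of every injective endomorphism is a direct summand. -/
def IsGenCoHopfian (G : Type*) [AddCommGroup G] : Prop :=
  ∀ φ : G →+ G, Function.Injective φ → IsComplemented φ.range

/-- `G` is hereditarily generalized co-Hopfian: every subgroup is generalized co-Hopfian. -/
def IsHereditarilyGenCoHopfian (G : Type*) [AddCommGroup G] : Prop :=
  ∀ H : AddSubgroup G, IsGenCoHopfian H

/-- An elementary group: every element has (finite) square-free order. An element of infinite order
has `addOrderOf` equal to `0`, which is not square-free. -/
def IsElementary (G : Type*) [AddCommGroup G] : Prop :=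
  ∀ x : G, Squarefree (addOrderOf x)

/-- `G` has no elementary direct summand except the zero subgroup. -/
def HasNoElementarySummand (G : Type*) [AddCommGroup G] : Prop :=
  ∀ E : AddSubgroup G, IsComplemented E → IsElementary E → E = ⊥

/-- A divisible group. -/
def IsDivisible (G : Type*) [AddCommGroup G] : Prop :=
  ∀ n : ℕ, n ≠ 0 → ∀ x : G, ∃ y : G, n • y = x

/-- `C` is the divisible part of `G`: the largest divisible subgroup. -/
def IsDivisiblePart {G : Type*} [AddCommGroup G] (C : AddSubgroup G) : Prop :=
  IsGreatest {D : AddSubgroup G | IsDivisible D} C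

/-- Independence in an abelian group (in the sense of Fuchs): the elements are nonzero and
`n₁ g₁ + ⋯ + nₖ gₖ = 0` with distinct `gᵢ ∈ S` forces every `nᵢ gᵢ = 0`. -/
def IsIndependent {G : Type*} [AddCommGroup G] (S : Set G) : Prop :=
  0 ∉ S ∧ ∀ c : G →₀ ℤ, (c.support : Set G) ⊆ S →
    (c.sum fun g n => n • g) = 0 → ∀ g ∈ c.support, c g • g = 0

/-- The independent sets used to define the rank of an abelian group: all elements are of
infinite order or of prime power order. -/
def IsRankSystem {G : Type*} [AddCommGroup G] (S : Set G) : Prop :=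
  IsIndependent S ∧ ∀ g ∈ S, addOrderOf g = 0 ∨ IsPrimePow (addOrderOf g)

/-- The rank of `G` is the cardinality of any maximal independent set of elements of infinite or
prime power order; `G` has finite rank if such a maximal set is finite. -/
def HasFiniteRank (G : Type*) [AddCommGroup G] : Prop :=
  ∃ S : Set G, Maximal IsRankSystem S ∧ S.Finite

end HerGenCoHopf

namespace HerGenCoHopf

/-! ### Elementary subgroups and complements inside them -/

section Elementary

variable {G : Type*} [AddCommGroup G]

/-! For a torsion group `G`, everything turns on one condition: for each prime `p`, the socle `pG ∩
G[p]` is finite.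

Necessity: an element of infinite order would give a subgroup `ℤ`, where doubling has a nonsplit
image. If `pG ∩ G[p]` is infinite, dividing independent elements of it by `p` yields a direct sum of
copies of `ℤ / p ^ 2`. This sum contains `shiftGroup p`, on which the shift is injective with
nonsplit image (`finite_socle_inter_nsmul`).

From the condition to the decomposition: let `Φ` be the intersection of all `pG`. Since `G / Φ` is
elementary, `G = B ⊕ A'` with `B` elementary, `Φ ≤ A'`, and every element of `A'` of square-free
order in `Φ` (`exists_elementary_isCompl`). The divisible part `C` lies in `Φ` and splits off from
`A'`, leaving `A`. The `p`-socles of `A` and `C` lie in `pG ∩ G[p]`, so they are finite. Hence `C`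
has finite `p`-ranks, and the reduced group `A` has finite `p`-components (`finite_of_reduced`).

Sufficiency: in a subgroup `H`, multiplication by `p` kills the `B`-part of the `p`-component `H_p`,
so `pH_p` has finite socle. An injective `φ` therefore maps `pH_p` onto itself, and `H` is the sum
of `φ(H)` and its elementary part. A complement of `φ(H)` is then found inside the elementary part
by Zorn's lemma (`isGenCoHopfian_of_finite_socle`). -/

lemma mem_of_coprime_nsmul_mem {K : AddSubgroup G} {x : G} {a b : ℕ} (h : a.Coprime b)
    (ha : a • x ∈ K) (hb : b • x ∈ K) : x ∈ K := by
  have e := Nat.gcd_eq_gcd_ab a b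
  rw [h.gcd_eq_one] at e
  have : x = (a.gcdA b) • (a • x) + (a.gcdB b) • (b • x) := by
    rw [← natCast_zsmul, ← natCast_zsmul, ← mul_zsmul, ← mul_zsmul, ← add_zsmul,
      mul_comm, mul_comm (a.gcdB b), ← e]
    simp
  rw [this]
  exact add_mem (zsmul_mem ha _) (zsmul_mem hb _)

/-- A torsion element lies in a subgroup as soon as its primary multiples do. -/
lemma mem_of_primary_multiples_mem {K : AddSubgroup G} {n : ℕ} :
    ∀ {x : G}, n ≠ 0 → n • x = 0 →
      (∀ p k : ℕ, p.Prime → ∀ m : ℕ, p ^ k • m • x = 0 → m • x ∈ K) → x ∈ K := by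
  induction n using Nat.recOnPosPrimePosCoprime with
  | prime_pow p n hp hn =>
    intro x _ hx h
    simpa using h p n hp 1 (by simpa using hx)
  | zero => intro x h; exact absurd rfl h
  | one =>
    intro x _ hx _
    rw [one_nsmul] at hx
    rw [hx]; exact zero_mem _
  | coprime a b ha hb hab iha ihb =>
    intro x _ hx h
    refine mem_of_coprime_nsmul_mem hab ?_ ?_
    -- `a • x` is killed by `b`, and its primary multiples are among those of `x`.
    · refine ihb (by omega) (by rw [← mul_nsmul, hx]) fun p k hp m hm => ?_
      rw [smul_smul m] at hm ⊢
      exact h p k hp _ hm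
    · refine iha (by omega) (by rw [← mul_nsmul', hx]) fun p k hp m hm => ?_
      rw [smul_smul m] at hm ⊢
      exact h p k hp _ hm

lemma prime_nsmul_eq_zero_of_squarefree {x : G} (hx : Squarefree (addOrderOf x)) {p k : ℕ}
    (hp : p.Prime) (h : p ^ k • x = 0) : p • x = 0 := by
  rw [← addOrderOf_dvd_iff_nsmul_eq_zero] at h ⊢
  obtain ⟨j, -, hj⟩ := (Nat.dvd_prime_pow hp).1 h
  rw [hj] at hx ⊢
  rcases j with - | - | j
  · simp
  · simp
  · exact absurd (hx p ⟨p ^ j, by ring⟩) hp.prime.not_isUnit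

lemma squarefree_addOrderOf_of_nsmul_eq_zero {x : G} {n : ℕ} (hn : Squarefree n)
    (h : n • x = 0) : Squarefree (addOrderOf x) :=
  hn.squarefree_of_dvd (addOrderOf_dvd_of_nsmul_eq_zero h)

lemma squarefree_lcm {m n : ℕ} (hm : Squarefree m) (hn : Squarefree n) :
    Squarefree (m.lcm n) := by
  have h0 := Nat.lcm_ne_zero hm.ne_zero hn.ne_zero
  rw [Nat.squarefree_iff_factorization_le_one h0]
  intro p
  rw [Nat.factorization_lcm hm.ne_zero hn.ne_zero, Finsupp.sup_apply]
  exact sup_le ((Nat.squarefree_iff_factorization_le_one hm.ne_zero).1 hm p)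
    ((Nat.squarefree_iff_factorization_le_one hn.ne_zero).1 hn p)

variable (G) in
/-- The largest elementary subgroup. -/
def elementaryPart : AddSubgroup G where
  carrier := {x | Squarefree (addOrderOf x)}
  zero_mem' := by simp
  add_mem' {x y} hx hy :=
    (squarefree_lcm hx hy).squarefree_of_dvd (AddCommute.all x y).addOrderOf_add_dvd_lcm
  neg_mem' {x} hx := by simpa using hx

lemma mem_elementaryPart_of_prime {x : G} {p : ℕ} (hp : p.Prime) (h : p • x = 0) :
    x ∈ elementaryPart G :=
  squarefree_addOrderOf_of_nsmul_eq_zero hp.prime.squarefree h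

lemma IsElementary.of_le {S : AddSubgroup G} (h : S ≤ elementaryPart G) : IsElementary S := by
  intro x
  rw [← AddSubgroup.addOrderOf_coe]
  exact h x.2

/-- Any subgroup `K` has, inside an elementary subgroup `S`, a complement of `K` in `K ⊔ S`. -/
lemma exists_disjoint_le_sup_of_elementary (K S : AddSubgroup G) (hS : S ≤ elementaryPart G) :
    ∃ W ≤ S, Disjoint K W ∧ S ≤ K ⊔ W := by
  obtain ⟨W, -, hW⟩ := zorn_le_nonempty₀ {W : AddSubgroup G | W ≤ S ∧ Disjoint K W} (by
    intro c hc hchain W₀ hW₀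
    refine ⟨sSup c, ⟨sSup_le fun W hW => (hc hW).1, ?_⟩, fun W hW => le_sSup hW⟩
    rw [AddSubgroup.disjoint_def]
    intro x hxK hx
    rw [AddSubgroup.mem_sSup_of_directedOn ⟨W₀, hW₀⟩ hchain.directedOn] at hx
    obtain ⟨W, hW, hxW⟩ := hx
    exact AddSubgroup.disjoint_def.1 (hc hW).2 hxK hxW) ⊥ ⟨bot_le, disjoint_bot_right⟩
  refine ⟨W, hW.prop.1, hW.prop.2, fun x hx => ?_⟩
  have hxS : Squarefree (addOrderOf x) := hS hx
  refine mem_of_primary_multiples_mem hxS.ne_zero (addOrderOf_nsmul_eq_zero x)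
    fun p k hp m hm => ?_
  have hyS : m • x ∈ S := nsmul_mem hx m
  have hy := prime_nsmul_eq_zero_of_squarefree (hS hyS) hp hm
  generalize m • x = y at hyS hy
  by_contra hyn
  -- An element `y` of order `p` outside `K ⊔ W` could be adjoined to `W` without meeting `K`,
  -- against maximality: `n • y ∈ K ⊔ W` with `p ∤ n` would force `y ∈ K ⊔ W`.
  have hmem : W ⊔ AddSubgroup.zmultiples y ∈ {W : AddSubgroup G | W ≤ S ∧ Disjoint K W} := by
    refine ⟨sup_le hW.prop.1 (by simpa using hyS), ?_⟩
    rw [AddSubgroup.disjoint_def]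
    intro z hzK hz
    obtain ⟨w, hw, t, ht, rfl⟩ := AddSubgroup.mem_sup.1 hz
    obtain ⟨n, rfl⟩ := AddSubgroup.mem_zmultiples_iff.1 ht
    by_cases hpn : (p : ℤ) ∣ n
    · obtain ⟨r, rfl⟩ := hpn
      have h0 : ((p : ℤ) * r) • y = 0 := by
        rw [mul_comm, mul_zsmul, natCast_zsmul, hy, zsmul_zero]
      rw [h0, add_zero] at hzK ⊢
      exact AddSubgroup.disjoint_def.1 hW.prop.2 hzK hw
    · exfalso
      apply hyn
      have hny : n • y ∈ K ⊔ W := by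
        have := sub_mem (AddSubgroup.mem_sup_left (T := W) hzK)
          (AddSubgroup.mem_sup_right (S := K) hw)
        simpa using this
      have hco : Nat.Coprime p n.natAbs :=
        (hp.coprime_iff_not_dvd).2 fun h => hpn (Int.natCast_dvd.2 h)
      refine mem_of_coprime_nsmul_mem hco (by rw [hy]; exact zero_mem _) ?_
      rcases Int.natAbs_eq n with h | h
      · rw [h, natCast_zsmul] at hny; exact hny
      · rw [h, neg_zsmul, natCast_zsmul] at hny; exact neg_mem_iff.1 hny
  have := hW.le_of_ge hmem le_sup_left
  exact hyn (AddSubgroup.mem_sup_right (this (AddSubgroup.mem_sup_right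
    (AddSubgroup.mem_zmultiples y))))

end Elementary

/-! ### Finite socles imply generalized co-Hopfian -/

section Finiteness

variable {G : Type*} [AddCommGroup G]

/-- If the `p`-socle is finite then so is the subgroup of elements killed by `p ^ n`. -/
lemma finite_pow_nsmul_eq_zero {p : ℕ} (h : {x : G | p • x = 0}.Finite) (n : ℕ) :
    {x : G | p ^ n • x = 0}.Finite := by
  induction n with
  | zero => simp
  | succ n ih =>
    have : {x : G | p ^ (n + 1) • x = 0} = (fun x => p • x) ⁻¹' {x : G | p ^ n • x = 0} := by
      ext x
      simp [smul_smul, pow_succ]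
    rw [this]
    -- Each nonempty fibre of multiplication by `p` is a coset of the finite `p`-socle.
    refine ih.preimage' fun b _ => ?_
    by_cases hb : ∃ y, p • y = b
    · obtain ⟨y, rfl⟩ := hb
      refine (h.image (fun z => y + z)).subset fun x hx => ⟨x - y, ?_, by simp⟩
      have hx' : p • x = p • y := hx
      simp [smul_sub, hx']
    · refine Set.Finite.subset Set.finite_empty fun x hx => hb ⟨x, hx⟩

/-- An injective endomorphism preserving a subgroup `M` with finite `p`-socle maps the `p`-primary
part of `M` onto itself. -/
lemma exists_preimage_of_finite_socle {p : ℕ} (M : AddSubgroup G) (φ : G →+ G)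
    (hφ : Function.Injective φ) (hM : ∀ x ∈ M, φ x ∈ M)
    (h : {x : G | x ∈ M ∧ p • x = 0}.Finite) {n : ℕ} {x : G} (hx : x ∈ M)
    (hn : p ^ n • x = 0) : ∃ y ∈ M, φ y = x := by
  have hfin : {x : M | p • x = 0}.Finite := by
    refine Set.Finite.of_finite_image (f := Subtype.val) (h.subset ?_)
      Subtype.val_injective.injOn
    rintro _ ⟨x, hx, rfl⟩
    exact ⟨x.2, by simpa using congrArg Subtype.val hx⟩
  have hfin' := finite_pow_nsmul_eq_zero hfin n
  let f : M → M := fun x => ⟨φ x, hM x x.2⟩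
  have hmaps : Set.MapsTo f {x : M | p ^ n • x = 0} {x : M | p ^ n • x = 0} := by
    intro x hx
    have : p ^ n • (x : G) = 0 := by simpa using congrArg Subtype.val hx
    ext
    simp [f, ← map_nsmul, this]
  have hinj : Set.InjOn f {x : M | p ^ n • x = 0} := by
    intro x _ y _ hxy
    exact Subtype.ext (hφ (congrArg Subtype.val hxy))
  have hsurj := ((hfin'.injOn_iff_bijOn_of_mapsTo hmaps).1 hinj).surjOn
  obtain ⟨y, -, hy⟩ := hsurj (show (⟨x, hx⟩ : M) ∈ _ from Subtype.ext (by simpa using hn))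
  exact ⟨y, y.2, congrArg Subtype.val hy⟩

/-- A torsion group in which the multiples by `p` of the `p`-component have, for every prime `p`,
finite `p`-socle is generalized co-Hopfian. -/
lemma isGenCoHopfian_of_finite_socle (htor : IsAddTorsion G)
    (h : ∀ p : ℕ, p.Prime →
      {x : G | p • x = 0 ∧ ∃ k : ℕ, ∃ y : G, p ^ k • y = 0 ∧ p • y = x}.Finite) :
    IsGenCoHopfian G := by
  intro φ hφ
  obtain ⟨W, -, hdisj, hle⟩ :=
    exists_disjoint_le_sup_of_elementary φ.range (elementaryPart G) le_rfl
  refine ⟨W, hdisj, codisjoint_iff.2 (eq_top_iff.2 fun x _ => ?_)⟩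
  have hx := (htor x).addOrderOf_pos.ne'
  refine mem_of_primary_multiples_mem hx (addOrderOf_nsmul_eq_zero x) fun p k hp m hm => ?_
  generalize m • x = y at hm
  have := Fact.mk hp
  -- `M` is `p` times the `p`-component. As `φ` maps it onto itself, `p • y = φ (p • u)` for some
  -- `u`, so `y - φ u` lies in the socle and hence in `φ.range ⊔ W`.
  let M : AddSubgroup G := (AddCommGroup.primaryComponent G p).map (nsmulAddMonoidHom p)
  have hMφ : ∀ z ∈ M, φ z ∈ M := by
    rintro _ ⟨z, ⟨k, hk⟩, rfl⟩
    exact ⟨φ z, ⟨k, by rw [← map_nsmul, hk, map_zero]⟩, by simp⟩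
  have hyM : p • y ∈ M := ⟨y, ⟨k, hm⟩, rfl⟩
  obtain ⟨z, ⟨u, -, rfl⟩, hz⟩ := exists_preimage_of_finite_socle (p := p) M φ hφ hMφ
    ((h p hp).subset (by
      rintro _ ⟨⟨z, ⟨k, hk⟩, rfl⟩, hx⟩
      exact ⟨hx, k, z, hk, rfl⟩)) hyM (n := k) (by rw [smul_comm, hm, smul_zero])
  have h0 : p • (y - φ u) = 0 := by
    rw [smul_sub, ← hz]
    simp
  have := add_mem (AddSubgroup.mem_sup_left (T := W) (show φ u ∈ φ.range from ⟨u, rfl⟩))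
    (hle (mem_elementaryPart_of_prime hp h0))
  simpa using this

end Finiteness

/-! ### Finite rank versus finite socle -/

section Rank

variable {G : Type*} [AddCommGroup G]

/-- A finite maximal system generates a finite group, since `G` is torsion. This group contains the
socle: an element of order `p` outside it could be adjoined to the system. -/
lemma finite_socle_of_hasFiniteRank {p : ℕ} (hp : p.Prime) (htor : IsAddTorsion G)
    (h : HasFiniteRank G) : {x : G | p • x = 0}.Finite := by
  obtain ⟨S, hS, hfin⟩ := h
  have hfg : (AddSubgroup.closure S).FG := ⟨hfin.toFinset, by simp⟩
  have : AddGroup.FG (AddSubgroup.closure S) := (AddGroup.fg_iff_addSubgroup_fg _).2 hfg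
  have := AddCommGroup.finite_of_fg_isAddTorsion _ (htor.addSubgroup (AddSubgroup.closure S))
  refine (Set.toFinite (AddSubgroup.closure S : Set G)).subset fun x hx => ?_
  have hx : p • x = 0 := hx
  by_contra hxS
  have hx0 : x ≠ 0 := fun h => hxS (h ▸ zero_mem _)
  have hxS' : x ∉ S := fun h => hxS (AddSubgroup.subset_closure h)
  have hord : addOrderOf x = p :=
    have := Fact.mk hp
    addOrderOf_eq_prime hx hx0
  refine hxS' (hS.le_of_ge (y := insert x S) ⟨⟨?_, ?_⟩, ?_⟩ (Set.subset_insert _ _)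
    (Set.mem_insert _ _))
  · simpa [hx0.symm] using hS.prop.1.1
  · classical
    intro c hc hsum
    have hsplit : c x • x + (c.erase x).sum (fun g n => n • g) = 0 := by
      rw [← hsum]
      exact Finsupp.add_sum_erase' c x (fun g n => n • g) (by simp)
    have hsub : ((c.erase x).support : Set G) ⊆ S := by
      intro g hg
      rw [Finset.mem_coe, Finsupp.support_erase, Finset.mem_erase] at hg
      exact (hc hg.2).resolve_left hg.1
    have hmem : (c.erase x).sum (fun g n => n • g) ∈ AddSubgroup.closure S :=
      sum_mem fun g hg => zsmul_mem (AddSubgroup.subset_closure (hsub hg)) _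
    have hcx : c x • x ∈ AddSubgroup.closure S := by
      rw [eq_neg_of_add_eq_zero_left hsplit]; exact neg_mem hmem
    have hcx0 : c x • x = 0 := by
      rw [← addOrderOf_dvd_iff_zsmul_eq_zero, hord]
      by_contra hnd
      apply hxS
      have hco : Nat.Coprime p (c x).natAbs :=
        (hp.coprime_iff_not_dvd).2 fun h => hnd (Int.natCast_dvd.2 h)
      refine mem_of_coprime_nsmul_mem hco (by rw [hx]; exact zero_mem _) ?_
      rcases Int.natAbs_eq (c x) with h | h
      · rw [h, natCast_zsmul] at hcx; exact hcx
      · rw [h, neg_zsmul, natCast_zsmul] at hcx; exact neg_mem_iff.1 hcx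
    rw [hcx0, zero_add] at hsplit
    have := hS.prop.1.2 _ hsub hsplit
    intro g hg
    by_cases hgx : g = x
    · rw [hgx]; exact hcx0
    · have := this g (by simp [hgx, Finsupp.mem_support_iff.1 hg])
      rwa [Finsupp.erase_ne hgx] at this
  · rintro g (rfl | hg)
    · right; rw [hord]; exact hp.prime.isPrimePow
    · exact hS.prop.2 g hg

/-- In a `p`-group with finite socle, the size of a rank system is bounded by that of the socle. -/
lemma hasFiniteRank_of_finite_socle {p : ℕ} (hp : p.Prime)
    (htor : ∀ x : G, ∃ k : ℕ, p ^ k • x = 0) (h : {x : G | p • x = 0}.Finite) :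
    HasFiniteRank G := by
  -- Each nonzero `g` has a nonzero multiple `p ^ k • g` in the socle. On an independent set these
  -- multiples are distinct, since a coincidence is a relation with nonzero terms.
  have key : ∀ g : G, g ≠ 0 → ∃ k : ℕ, p ^ k • g ≠ 0 ∧ p • p ^ k • g = 0 := by
    intro g hg
    classical
    have hk := Nat.find_spec (htor g)
    obtain ⟨k, hk'⟩ := Nat.exists_eq_succ_of_ne_zero (n := Nat.find (htor g))
      (fun h0 => hg (by rw [h0] at hk; simpa using hk))
    refine ⟨k, Nat.find_min (htor g) (by omega), ?_⟩
    rw [hk', pow_succ', mul_nsmul'] at hk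
    exact hk
  choose! f hf0 hf using key
  have hbound : ∀ S : Set G, IsRankSystem S → S.Finite ∧ S.ncard ≤ {x : G | p • x = 0}.ncard := by
    intro S hS
    have hne : ∀ g ∈ S, g ≠ 0 := fun g hg h0 => hS.1.1 (h0 ▸ hg)
    have hmaps : Set.MapsTo (fun g => p ^ f g • g) S {x : G | p • x = 0} :=
      fun g hg => hf g (hne g hg)
    have hinj : Set.InjOn (fun g => p ^ f g • g) S := by
      intro g hg g' hg' heq
      by_contra hgg
      have heq : p ^ f g • g = p ^ f g' • g' := heq
      let c : G →₀ ℤ := Finsupp.single g ((p ^ f g : ℕ) : ℤ) - Finsupp.single g' ((p ^ f g' : ℕ) : ℤ)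
      have hcg : c g = (p ^ f g : ℕ) := by simp [c, hgg]
      have hsupp : (c.support : Set G) ⊆ S := by
        intro t ht
        by_contra htS
        have h1 : t ≠ g := fun h => htS (h ▸ hg)
        have h2 : t ≠ g' := fun h => htS (h ▸ hg')
        exact (Finsupp.mem_support_iff.1 ht) (by simp [c, h1.symm, h2.symm])
      have hsum : (c.sum fun g n => n • g) = 0 := by
        rw [Finsupp.sum_sub_index (fun _ _ _ => sub_smul _ _ _)]
        rw [Finsupp.sum_single_index (by simp), Finsupp.sum_single_index (by simp),
          natCast_zsmul, natCast_zsmul, heq, sub_self]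
      have hpow : (p ^ f g : ℕ) ≠ 0 := pow_ne_zero _ hp.ne_zero
      have := hS.1.2 c hsupp hsum g (by
        rw [Finsupp.mem_support_iff, hcg]; exact_mod_cast hpow)
      rw [hcg, natCast_zsmul] at this
      exact hf0 g (hne g hg) this
    exact ⟨Set.Finite.of_injOn hmaps hinj h, Set.ncard_le_ncard_of_injOn _ hmaps hinj h⟩
  -- A rank system of largest size is maximal. All rank systems are finite by `hbound`, so `ncard`
  -- is their true size.
  have hex : ∃ n, ∃ S : Set G, IsRankSystem S ∧ S.ncard = n :=
    ⟨_, ∅, ⟨⟨by simp, fun c hc _ g hg => absurd (hc hg) (by simp)⟩, by simp⟩, rfl⟩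
  have hbdd : BddAbove {n | ∃ S : Set G, IsRankSystem S ∧ S.ncard = n} :=
    ⟨_, by rintro _ ⟨S, hS, rfl⟩; exact (hbound S hS).2⟩
  obtain ⟨S, hS, hcard⟩ := Nat.sSup_mem hex hbdd
  refine ⟨S, ⟨hS, fun T hT hST => ?_⟩, (hbound S hS).1⟩
  have : T.ncard ≤ S.ncard := by rw [hcard]; exact le_csSup hbdd ⟨T, hT, rfl⟩
  exact (Set.eq_of_subset_of_ncard_le hST this (hbound T hT).1).ge

end Rank

end HerGenCoHopf

namespace HerGenCoHopf

/-! ### Groups that are not generalized co-Hopfian, and how they embed -/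

section Obstructions

variable {G M : Type*} [AddCommGroup G] [AddCommGroup M]

/-- A group embedding into a hereditarily generalized co-Hopfian group is generalized
co-Hopfian. -/
lemma IsHereditarilyGenCoHopfian.of_injective (h : IsHereditarilyGenCoHopfian G) (f : M →+ G)
    (hf : Function.Injective f) : IsGenCoHopfian M := by
  intro φ hφ
  let e : M ≃+ f.range := AddMonoidHom.ofInjective hf
  let ψ : f.range →+ f.range := (e.toAddMonoidHom.comp φ).comp e.symm.toAddMonoidHom
  have hψ : Function.Injective ψ := e.injective.comp (hφ.comp e.symm.injective)
  obtain ⟨L, hL⟩ := h f.range ψ hψ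
  refine ⟨e.mapAddSubgroup.symm L, ?_⟩
  have hrange : φ.range = e.mapAddSubgroup.symm ψ.range := by
    rw [OrderIso.eq_symm_apply]
    ext x
    constructor
    · rintro ⟨_, ⟨y, rfl⟩, rfl⟩
      exact ⟨e y, by simp [ψ]⟩
    · rintro ⟨y, rfl⟩
      exact ⟨φ (e.symm y), ⟨_, rfl⟩, rfl⟩
  rw [hrange]
  exact e.mapAddSubgroup.symm.isCompl hL

lemma not_isGenCoHopfian_int : ¬ IsGenCoHopfian ℤ := by
  intro h
  obtain ⟨L, hL⟩ := h (zmultiplesHom ℤ 2) (fun a b hab => by simpa using hab)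
  have hmem : ∀ k : ℤ, 2 * k ∈ (zmultiplesHom ℤ (2 : ℤ)).range := fun k => ⟨k, by simp; ring⟩
  have hL0 : ∀ l ∈ L, l = 0 := by
    intro l hl
    have := AddSubgroup.disjoint_def.1 hL.disjoint (hmem l)
      (by rw [two_mul]; exact add_mem hl hl)
    omega
  obtain ⟨k, ⟨m, rfl⟩, l, hl, hkl⟩ := AddSubgroup.mem_sup.1
    (show (1 : ℤ) ∈ (zmultiplesHom ℤ (2 : ℤ)).range ⊔ L by rw [hL.sup_eq_top]; trivial)
  rw [hL0 l hl] at hkl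
  simp at hkl
  omega

lemma IsHereditarilyGenCoHopfian.isAddTorsion (h : IsHereditarilyGenCoHopfian G) :
    IsAddTorsion G := by
  intro x
  by_contra hx
  refine not_isGenCoHopfian_int (h.of_injective (zmultiplesHom G x) fun a b hab => ?_)
  exact injective_zsmul_iff_not_isOfFinAddOrder.2 hx (by simpa using hab)

/-- The finitely supported families indexed by `ℤ` in `ℤ / p ^ 2` whose negatively indexed terms
are killed by `p`. -/
def shiftGroup (p : ℕ) : AddSubgroup (ℤ →₀ ZMod (p ^ 2)) where
  carrier := {b | ∀ i < 0, p • b i = 0}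
  zero_mem' := by simp
  add_mem' ha hb i hi := by rw [Finsupp.add_apply, smul_add, ha i hi, hb i hi, add_zero]
  neg_mem' ha i hi := by rw [Finsupp.neg_apply, smul_neg, ha i hi, neg_zero]

/-- The shift by one place is an injective endomorphism whose image is not a direct summand. -/
lemma not_isGenCoHopfian_shiftGroup {p : ℕ} (hp : p.Prime) : ¬ IsGenCoHopfian (shiftGroup p) := by
  intro h
  let σ : (ℤ →₀ ZMod (p ^ 2)) ≃+ (ℤ →₀ ZMod (p ^ 2)) := Finsupp.domCongr (Equiv.addRight 1)
  have hσ : ∀ b i, σ b i = b (i - 1) := fun b i => by simp [σ, sub_eq_add_neg]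
  let φ : shiftGroup p →+ shiftGroup p :=
    (σ.toAddMonoidHom.comp (shiftGroup p).subtype).codRestrict (shiftGroup p) fun b i hi => by
      have := b.2 (i - 1) (by omega)
      simpa [hσ] using this
  have hφ : ∀ b i, (φ b : ℤ →₀ ZMod (p ^ 2)) i = (b : ℤ →₀ ZMod (p ^ 2)) (i - 1) :=
    fun b i => hσ b i
  have hinj : Function.Injective φ := fun a b hab =>
    Subtype.ext (σ.injective (congrArg Subtype.val hab))
  obtain ⟨L, hL⟩ := h φ hinj
  have hpp : (p : ZMod (p ^ 2)) * p = 0 := by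
    rw [← Nat.cast_mul, ← sq, ZMod.natCast_self]
  -- `δ` is the generator at place `0`; it is not in the image, because place `-1` allows only
  -- elements killed by `p`. But `p • δ = φ ε` is in the image. Writing `δ = φ m + l` with `l` in a
  -- complement forces `p • l = 0`, so `p • δ = p • φ m`. At place `0` this reads `p = p • m (-1) =
  -- 0` in `ℤ / p ^ 2`.
  let δ : shiftGroup p := ⟨Finsupp.single 0 1, fun i hi => by simp [hi.ne']⟩
  let ε : shiftGroup p := ⟨Finsupp.single (-1) (p : ZMod (p ^ 2)), fun i _ => by
    by_cases hi : i = -1 <;> simp [hi, hpp]⟩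
  have hδ : φ ε = p • δ := by
    ext i
    rw [hφ]
    by_cases hi : i = 0
    · subst hi; simp [ε, δ]
    · have : -1 ≠ i - 1 := by omega
      simp [ε, δ, this, Ne.symm hi]
  obtain ⟨_, ⟨m, rfl⟩, l, hl, hkl⟩ := AddSubgroup.mem_sup.1
    (show δ ∈ φ.range ⊔ L by rw [hL.sup_eq_top]; trivial)
  have hpl : p • l = 0 := by
    refine AddSubgroup.disjoint_def.1 hL.disjoint ?_ (nsmul_mem hl p)
    have : p • l = φ (ε - p • m) := by
      rw [map_sub, map_nsmul, hδ, ← hkl, nsmul_add, add_sub_cancel_left]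
    rw [this]; exact ⟨_, rfl⟩
  have hfin : p • δ = p • φ m := by rw [← hkl, nsmul_add, hpl, add_zero]
  have h0 := congrArg (fun b : shiftGroup p => (b : ℤ →₀ ZMod (p ^ 2)) 0) hfin
  have hm := m.2 (-1) (by norm_num)
  simp only [AddSubgroup.coe_nsmul, Finsupp.smul_apply, hφ] at h0
  rw [zero_sub, hm] at h0
  have h1 : ((p : ℕ) : ZMod (p ^ 2)) = 0 := by simpa [δ] using h0
  rw [ZMod.natCast_eq_zero_iff] at h1
  have := Nat.le_of_dvd hp.pos h1
  nlinarith [hp.two_le]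

/-- A family with independent multiples by `p`, all of order `p`, spans a copy of a direct sum of
cyclic groups of order `p ^ 2`. -/
lemma exists_injective_of_independent {p : ℕ} [hp : Fact p.Prime] {ι : Type*} (x : ι → G)
    (hx : ∀ i, p ^ 2 • x i = 0)
    (hind : ∀ (s : Finset ι) (c : ι → ℕ), ∑ i ∈ s, c i • p • x i = 0 → ∀ i ∈ s, p ∣ c i) :
    ∃ f : (ι →₀ ZMod (p ^ 2)) →+ G, Function.Injective f := by
  let f : (ι →₀ ZMod (p ^ 2)) →+ G := Finsupp.liftAddHom fun i =>
    ZMod.lift (p ^ 2) ⟨zmultiplesHom G (x i), by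
      rw [zmultiplesHom_apply, natCast_zsmul, hx i]⟩
  have hlift : ∀ i (z : ZMod (p ^ 2)),
      ZMod.lift (p ^ 2) ⟨zmultiplesHom G (x i), by
      rw [zmultiplesHom_apply, natCast_zsmul, hx i]⟩ z = z.val • x i := by
    intro i z
    conv_lhs => rw [← ZMod.natCast_zmod_val z, ← Int.cast_natCast (R := ZMod (p ^ 2)), ZMod.lift_coe]
    exact natCast_zsmul _ _
  have hf : ∀ b, f b = ∑ i ∈ b.support, (b i).val • x i := by
    intro b
    simp only [f, Finsupp.liftAddHom_apply, Finsupp.sum]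
    exact Finset.sum_congr rfl fun i _ => hlift i _
  refine ⟨f, (injective_iff_map_eq_zero f).2 fun b hb => ?_⟩
  rw [hf] at hb
  -- Independence is used twice: on `p` times the relation, giving `p ∣ (b i).val`, and then on the
  -- relation itself with coefficients `(b i).val / p`. Thus `p ^ 2` divides a value below `p ^ 2`.
  have h1 : ∀ i ∈ b.support, p ∣ (b i).val := by
    apply hind
    have := congrArg (fun y => p • y) hb
    simp only [Finset.smul_sum, smul_zero] at this
    rw [← this]
    exact Finset.sum_congr rfl fun i _ => smul_comm _ _ _
  have h2 : ∀ i ∈ b.support, p ∣ (b i).val / p := by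
    apply hind
    rw [← hb]
    refine Finset.sum_congr rfl fun i hi => ?_
    rw [smul_smul, Nat.div_mul_cancel (h1 i hi)]
  ext i
  by_contra hi
  have hi' : i ∈ b.support := Finsupp.mem_support_iff.2 hi
  have hdvd : p ^ 2 ∣ (b i).val := by
    have := Nat.mul_dvd_mul_right (h2 i hi') p
    rwa [Nat.div_mul_cancel (h1 i hi'), ← sq] at this
  have := Nat.eq_zero_of_dvd_of_lt hdvd (ZMod.val_lt _)
  exact hi ((ZMod.val_eq_zero _).1 this)

lemma exists_linearIndependent_int_of_infinite {p : ℕ} [Fact p.Prime] (V : Type*)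
    [AddCommGroup V] [Module (ZMod p) V] [hV : Infinite V] :
    ∃ v : ℤ → V, LinearIndependent (ZMod p) v := by
  let B := Module.Basis.ofVectorSpace (ZMod p) V
  have hinf : Infinite (Module.Basis.ofVectorSpaceIndex (ZMod p) V) := by
    by_contra hfin
    rw [not_infinite_iff_finite] at hfin
    have := Module.Finite.of_basis B
    exact hV.not_finite (Module.finite_of_finite (ZMod p))
  let e : ℤ ↪ Module.Basis.ofVectorSpaceIndex (ZMod p) V :=
    Equiv.intEquivNat.toEmbedding.trans (Infinite.natEmbedding _)
  exact ⟨_, B.linearIndependent.comp e e.injective⟩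

/-- If infinite, this set is an infinite-dimensional space over `ZMod p`. Preimages under `p` of
independent vectors indexed by `ℤ` span a direct sum of copies of `ℤ / p ^ 2`, which contains the
forbidden `shiftGroup p`. -/
lemma IsHereditarilyGenCoHopfian.finite_socle_inter_nsmul (h : IsHereditarilyGenCoHopfian G)
    {p : ℕ} (hp : p.Prime) : {v : G | p • v = 0 ∧ ∃ x, p • x = v}.Finite := by
  have := Fact.mk hp
  by_contra hinf
  let V : AddSubgroup G :=
    { carrier := {v : G | p • v = 0 ∧ ∃ x, p • x = v}
      zero_mem' := ⟨by simp, 0, by simp⟩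
      add_mem' := by
        rintro _ _ ⟨ha, x, rfl⟩ ⟨hb, y, rfl⟩
        exact ⟨by rw [smul_add, ha, hb, add_zero], x + y, smul_add _ _ _⟩
      neg_mem' := by
        rintro _ ⟨ha, x, rfl⟩
        exact ⟨by rw [smul_neg, ha, neg_zero], -x, smul_neg _ _⟩ }
  have hV : ∀ v : V, p • v = 0 := fun v => Subtype.ext (by simpa using v.2.1)
  let _ : Module (ZMod p) V := AddCommGroup.zmodModule hV
  have hVinf : Infinite V := Set.infinite_coe_iff.2 hinf
  obtain ⟨v, hlin⟩ := exists_linearIndependent_int_of_infinite (p := p) V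
  choose x hx using fun i : ℤ => (v i).2.2
  obtain ⟨f, hf⟩ := exists_injective_of_independent (p := p) x
    (fun i => by rw [sq, mul_nsmul, hx]; exact (v i).2.1) (fun s c hc i hi => by
      have := linearIndependent_iff'.1 hlin s (fun i => (c i : ZMod p)) (by
        apply Subtype.ext
        rw [AddSubgroup.val_finsetSum, ← hc.trans (ZeroMemClass.coe_zero V).symm]
        refine Finset.sum_congr rfl fun j _ => ?_
        simp [Nat.cast_smul_eq_nsmul, hx]) i hi
      rwa [ZMod.natCast_eq_zero_iff] at this)
  exact not_isGenCoHopfian_shiftGroup hp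
    (h.of_injective (f.comp (shiftGroup p).subtype) (hf.comp Subtype.val_injective))

end Obstructions

/-! ### Divisible subgroups and reduced `p`-groups -/

section Divisible

variable {G : Type*} [AddCommGroup G]

variable (G) in
lemma exists_isDivisiblePart : ∃ C : AddSubgroup G, IsDivisiblePart C := by
  refine ⟨sSup {D | IsDivisible D}, fun n hn x => ?_, fun D hD => le_sSup hD⟩
  suffices h : ∀ x ∈ sSup {D : AddSubgroup G | IsDivisible D},
      ∃ y ∈ sSup {D : AddSubgroup G | IsDivisible D}, n • y = x by
    obtain ⟨y, hy, hyx⟩ := h x x.2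
    exact ⟨⟨y, hy⟩, Subtype.ext hyx⟩
  intro x hx
  rw [sSup_eq_iSup'] at hx
  induction hx using AddSubgroup.iSup_induction' with
  | hp D x hx =>
    obtain ⟨y, hy⟩ := D.2 n hn ⟨x, hx⟩
    exact ⟨y, le_sSup D.2 y.2, congrArg Subtype.val hy⟩
  | h1 => exact ⟨0, zero_mem _, smul_zero _⟩
  | hadd x y _ _ hx hy =>
    obtain ⟨a, ha, rfl⟩ := hx
    obtain ⟨b, hb, rfl⟩ := hy
    exact ⟨a + b, add_mem ha hb, smul_add _ _ _⟩

/-- Divisible groups are injective by Baer's criterion, so the identity of `C` extends to a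
retraction `r` of `G`, whose kernel is a complement. -/
lemma IsDivisible.isComplemented {C : AddSubgroup G} (hC : IsDivisible C) : IsComplemented C := by
  classical
  choose! d hd using hC
  let _ : DivisibleBy C ℕ :=
    { div := fun x n => if n = 0 then 0 else d n x
      div_zero := by simp
      div_cancel := fun {n} x hn => by simp [hn, hd n hn x] }
  let _ : DivisibleBy C ℤ := AddGroup.divisibleByIntOfDivisibleByNat C
  obtain ⟨r, hr⟩ := (Module.Baer.of_divisible C).extension_property_addMonoidHom C.subtype
    Subtype.val_injective (AddMonoidHom.id C)
  have hr' : ∀ c : C, r c = c := fun c => DFunLike.congr_fun hr c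
  refine ⟨r.ker, AddSubgroup.disjoint_def.2 fun {x} hx hk => ?_,
    codisjoint_iff.2 (eq_top_iff.2 fun x _ => ?_)⟩
  · have := hr' ⟨x, hx⟩
    rw [show r x = 0 from hk] at this
    exact (congrArg Subtype.val this).symm
  · refine AddSubgroup.mem_sup.2 ⟨r x, (r x).2, x - r x, ?_, by abel⟩
    rw [AddMonoidHom.mem_ker, map_sub, hr', sub_self]

/-- A `p`-divisible `p`-group is divisible. -/
lemma isDivisible_of_prime {p : ℕ} (hp : p.Prime) (htor : ∀ x : G, ∃ k : ℕ, p ^ k • x = 0)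
    (h : ∀ x : G, ∃ y, p • y = x) : IsDivisible G := by
  intro n hn
  induction n using Nat.recOnMul with
  | zero => exact absurd rfl hn
  | one => exact fun x => ⟨x, one_nsmul x⟩
  | prime q hq =>
    intro x
    by_cases hqp : q = p
    · exact hqp ▸ h x
    · obtain ⟨k, hk⟩ := htor x
      have hco : (q).Coprime (p ^ k) := ((Nat.coprime_primes hq hp).2 hqp).pow_right k
      have := mem_of_coprime_nsmul_mem (K := (nsmulAddMonoidHom (α := G) q).range) hco
        ⟨x, rfl⟩ (by rw [hk]; exact zero_mem _)
      exact this
  | mul a b iha ihb =>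
    intro x
    obtain ⟨y, rfl⟩ := iha (left_ne_zero_of_mul hn) x
    obtain ⟨z, rfl⟩ := ihb (right_ne_zero_of_mul hn) y
    exact ⟨z, mul_smul _ _ _⟩

/-- A reduced `p`-group with finite socle is finite. -/
lemma finite_of_reduced {p : ℕ} (hp : p.Prime) (htor : ∀ x : G, ∃ k : ℕ, p ^ k • x = 0)
    (hred : ∀ D : AddSubgroup G, IsDivisible D → D = ⊥) (h : {x : G | p • x = 0}.Finite) :
    Finite G := by
  -- The socles of the subgroups `p ^ n G` form a decreasing chain of finite sets, hence stabilise
  -- at some `n`. It follows that `N = p ^ n G` is `p`-divisible, so zero by reducedness, and `G` is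
  -- killed by `p ^ n`.
  let W : ℕ → Set G := fun n => {x | p • x = 0 ∧ ∃ y, p ^ n • y = x}
  have hW : ∀ n, (W n).Finite := fun n => h.subset fun x hx => hx.1
  have hanti : ∀ m n, m ≤ n → W n ⊆ W m := by
    rintro m n hmn x ⟨hx, y, rfl⟩
    refine ⟨hx, p ^ (n - m) • y, ?_⟩
    rw [smul_smul, ← pow_add, Nat.add_sub_cancel' hmn]
  obtain ⟨n, hn⟩ : ∃ n, ∀ m, (W n).ncard ≤ (W m).ncard := by
    obtain ⟨n, hn⟩ := WellFounded.has_min (wellFounded_lt (α := ℕ))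
      (Set.range fun n => (W n).ncard) ⟨_, 0, rfl⟩
    obtain ⟨⟨n, rfl⟩, hn⟩ := hn
    exact ⟨n, fun m => not_lt.1 (hn _ ⟨m, rfl⟩)⟩
  have hstab : ∀ m, n ≤ m → W m = W n := fun m hm =>
    Set.eq_of_subset_of_ncard_le (hanti n m hm) (hn m) (hW n)
  let N : AddSubgroup G := (nsmulAddMonoidHom (p ^ n)).range
  have hdiv : ∀ k, ∀ x ∈ N, p ^ k • x = 0 → ∃ y ∈ N, p • y = x := by
    intro k
    induction k with
    | zero => intro x _ hx; exact ⟨0, zero_mem _, by simpa using hx.symm⟩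
    | succ k ih =>
      rintro _ ⟨z, rfl⟩ hx
      simp only [nsmulAddMonoidHom_apply] at hx ⊢
      -- By stability this socle element is divisible by `p ^ (n + (k + 1))`. Subtracting `p • p ^ n
      -- • y` from `p ^ n • z` leaves an element of `N` killed by `p ^ k`, to which the induction
      -- applies.
      have hmem : p ^ k • p ^ n • z ∈ W (n + (k + 1)) := by
        rw [hstab _ (by omega)]
        refine ⟨by rw [smul_smul, ← pow_succ']; exact hx, p ^ k • z, smul_comm _ _ _⟩
      obtain ⟨-, y, hy⟩ := hmem
      have hy' : p ^ k • p • p ^ n • y = p ^ k • p ^ n • z := by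
        rw [← hy]
        simp only [smul_smul]
        congr 1; ring
      obtain ⟨w, hw, hwx⟩ := ih (p ^ n • z - p • p ^ n • y) ⟨z - p • y, by
        rw [nsmulAddMonoidHom_apply, smul_sub, smul_comm p]⟩ (by rw [smul_sub, hy', sub_self])
      refine ⟨w + p ^ n • y, add_mem hw ⟨y, rfl⟩, ?_⟩
      rw [smul_add, hwx]; abel
  have hN : N = ⊥ := hred N (isDivisible_of_prime hp
    (fun x => (htor x).imp fun k hk => Subtype.ext (by simpa using hk)) fun x => by
      obtain ⟨k, hk⟩ := htor x
      obtain ⟨y, hy, hyx⟩ := hdiv k x x.2 hk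
      exact ⟨⟨y, hy⟩, Subtype.ext hyx⟩)
  refine Set.finite_univ_iff.1 ((finite_pow_nsmul_eq_zero h n).subset fun x _ => ?_)
  have : p ^ n • x ∈ N := ⟨x, rfl⟩
  rwa [hN, AddSubgroup.mem_bot] at this

end Divisible

/-! ### Internal direct sums of three subgroups, elementwise -/

section Internal

variable {G : Type*} [AddCommGroup G]

lemma isInternal_fin_three_iff (D : Fin 3 → AddSubgroup G) :
    DirectSum.IsInternal D ↔
      (∀ a ∈ D 0, ∀ b ∈ D 1, ∀ c ∈ D 2, a + b + c = 0 → a = 0 ∧ b = 0 ∧ c = 0) ∧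
        ∀ x, ∃ a ∈ D 0, ∃ b ∈ D 1, ∃ c ∈ D 2, a + b + c = x := by
  have key : ∀ f : DirectSum (Fin 3) fun i => D i,
      DirectSum.coeAddMonoidHom D f = (f 0 : G) + (f 1 : G) + (f 2 : G) := by
    classical
    intro f
    rw [DirectSum.coeAddMonoidHom_eq_dfinsuppSum, DFinsupp.sum_eq_sum_fintype _ (by simp),
      Fin.sum_univ_three]
    rfl
  let mk : D 0 → D 1 → D 2 → DirectSum (Fin 3) fun i => D i := fun a b c =>
    DirectSum.of (fun i => D i) 0 a + DirectSum.of (fun i => D i) 1 b +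
      DirectSum.of (fun i => D i) 2 c
  have hmk0 : ∀ a b c, mk a b c 0 = a := fun a b c => by
    simp only [mk, DirectSum.add_apply, DirectSum.of_eq_same]
    rw [DirectSum.of_eq_of_ne 1 0 _ (by decide), DirectSum.of_eq_of_ne 2 0 _ (by decide)]
    simp
  have hmk1 : ∀ a b c, mk a b c 1 = b := fun a b c => by
    simp only [mk, DirectSum.add_apply, DirectSum.of_eq_same]
    rw [DirectSum.of_eq_of_ne 0 1 _ (by decide), DirectSum.of_eq_of_ne 2 1 _ (by decide)]
    simp
  have hmk2 : ∀ a b c, mk a b c 2 = c := fun a b c => by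
    simp only [mk, DirectSum.add_apply, DirectSum.of_eq_same]
    rw [DirectSum.of_eq_of_ne 0 2 _ (by decide), DirectSum.of_eq_of_ne 1 2 _ (by decide)]
    simp
  rw [DirectSum.IsInternal, Function.Bijective, injective_iff_map_eq_zero]
  refine and_congr ⟨fun h a ha b hb c hc habc => ?_, fun h f hf => ?_⟩
    ⟨fun h x => ?_, fun h x => ?_⟩
  · have h0 := h (mk ⟨a, ha⟩ ⟨b, hb⟩ ⟨c, hc⟩) (by rw [key, hmk0, hmk1, hmk2]; exact habc)
    refine ⟨?_, ?_, ?_⟩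
    · have := hmk0 ⟨a, ha⟩ ⟨b, hb⟩ ⟨c, hc⟩
      rw [h0] at this; exact (congrArg Subtype.val this).symm
    · have := hmk1 ⟨a, ha⟩ ⟨b, hb⟩ ⟨c, hc⟩
      rw [h0] at this; exact (congrArg Subtype.val this).symm
    · have := hmk2 ⟨a, ha⟩ ⟨b, hb⟩ ⟨c, hc⟩
      rw [h0] at this; exact (congrArg Subtype.val this).symm
  · rw [key] at hf
    obtain ⟨h0, h1, h2⟩ := h _ (f 0).2 _ (f 1).2 _ (f 2).2 hf
    ext i
    fin_cases i
    · exact h0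
    · exact h1
    · exact h2
  · obtain ⟨f, rfl⟩ := h x
    exact ⟨_, (f 0).2, _, (f 1).2, _, (f 2).2, (key f).symm⟩
  · obtain ⟨a, ha, b, hb, c, hc, rfl⟩ := h x
    exact ⟨mk ⟨a, ha⟩ ⟨b, hb⟩ ⟨c, hc⟩, by rw [key, hmk0, hmk1, hmk2]⟩

end Internal

end HerGenCoHopf

namespace HerGenCoHopf

/-! ### The decomposition and its converse -/

section Structure

variable {G : Type*} [AddCommGroup G]

variable (G) in
/-- The intersection of the subgroups `pG`, `p` prime. -/
def frattini : AddSubgroup G where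
  carrier := {x | ∀ p : ℕ, p.Prime → ∃ y, p • y = x}
  zero_mem' p _ := ⟨0, smul_zero _⟩
  add_mem' ha hb p hp := by
    obtain ⟨x, rfl⟩ := ha p hp
    obtain ⟨y, rfl⟩ := hb p hp
    exact ⟨x + y, smul_add _ _ _⟩
  neg_mem' ha p hp := by
    obtain ⟨x, rfl⟩ := ha p hp
    exact ⟨-x, smul_neg _ _⟩

/-- A prime dividing `n` divides the radical; for any other prime, multiplication by it is
invertible on the cyclic group of `x`. This is what makes `G ⧸ frattini G` elementary. -/
lemma radical_nsmul_mem_frattini {x : G} {n : ℕ} (hn : n ≠ 0) (hx : n • x = 0) :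
    UniqueFactorizationMonoid.radical n • x ∈ frattini G := by
  intro p hp
  by_cases hpn : p ∣ n
  · have : p ∣ UniqueFactorizationMonoid.radical n :=
      (UniqueFactorizationMonoid.dvd_radical_iff_of_irreducible hp hn).2 hpn
    obtain ⟨m, hm⟩ := this
    exact ⟨m • x, by rw [hm, mul_smul]⟩
  · have hco : p.Coprime n := (hp.coprime_iff_not_dvd).2 hpn
    obtain ⟨y, hy⟩ := mem_of_coprime_nsmul_mem (K := (nsmulAddMonoidHom (α := G) p).range) hco
      ⟨x, rfl⟩ (by rw [hx]; exact zero_mem _)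
    exact ⟨UniqueFactorizationMonoid.radical n • y, by
      rw [← hy, nsmulAddMonoidHom_apply, smul_comm]⟩

lemma elementaryPart_quotient_frattini (htor : IsAddTorsion G) :
    elementaryPart (G ⧸ frattini G) = ⊤ := by
  refine eq_top_iff.2 fun x _ => ?_
  obtain ⟨x, rfl⟩ := QuotientAddGroup.mk_surjective x
  refine squarefree_addOrderOf_of_nsmul_eq_zero
    (UniqueFactorizationMonoid.squarefree_radical (a := addOrderOf x)) ?_
  rw [← QuotientAddGroup.mk_nsmul, QuotientAddGroup.eq_zero_iff]
  exact radical_nsmul_mem_frattini (htor x).addOrderOf_pos.ne' (addOrderOf_nsmul_eq_zero x)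

/-- A torsion group has an elementary direct summand with a complement whose elements of square-free
order are divisible by every prime. -/
lemma exists_elementary_isCompl (htor : IsAddTorsion G) :
    ∃ B A : AddSubgroup G, B ≤ elementaryPart G ∧ IsCompl B A ∧ frattini G ≤ A ∧
      A ⊓ elementaryPart G ≤ frattini G := by
  obtain ⟨B, hB, hdisj, hsup⟩ :=
    exists_disjoint_le_sup_of_elementary (frattini G) (elementaryPart G) le_rfl
  let π := QuotientAddGroup.mk' (frattini G)
  -- The quotient is elementary, so the image of `B` has a complement `W` there. The preimage of `W`
  -- complements `B`, because `B` meets the kernel `frattini G` trivially.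
  obtain ⟨W, -, hW, hWsup⟩ := exists_disjoint_le_sup_of_elementary (B.map π) ⊤
    (elementaryPart_quotient_frattini htor).ge
  have hker : ∀ x, π x = 0 ↔ x ∈ frattini G := fun x => QuotientAddGroup.eq_zero_iff x
  have hle : frattini G ≤ W.comap π := fun x hx => by
    rw [AddSubgroup.mem_comap, (hker x).2 hx]; exact zero_mem _
  have hBA : Disjoint B (W.comap π) := AddSubgroup.disjoint_def.2 fun {x} hx hxW =>
    AddSubgroup.disjoint_def.1 hdisj
      ((hker x).1 (AddSubgroup.disjoint_def.1 hW ⟨x, hx, rfl⟩ hxW)) hx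
  refine ⟨B, W.comap π, hB, ⟨hBA, codisjoint_iff.2 (eq_top_iff.2 fun x _ => ?_)⟩, hle, ?_⟩
  · obtain ⟨_, ⟨b, hb, rfl⟩, w, hw, hbw⟩ := AddSubgroup.mem_sup.1
      (hWsup (show π x ∈ (⊤ : AddSubgroup _) from trivial))
    refine AddSubgroup.mem_sup.2 ⟨b, hb, x - b, ?_, by abel⟩
    rw [AddSubgroup.mem_comap, map_sub, ← hbw, add_sub_cancel_left]
    exact hw
  · rintro x ⟨hxA, hxS⟩
    obtain ⟨f, hf, b, hb, rfl⟩ := AddSubgroup.mem_sup.1 (hsup hxS)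
    have hbA : b ∈ W.comap π := by
      have := sub_mem (show f + b ∈ W.comap π from hxA) (hle hf)
      simpa using this
    rw [AddSubgroup.disjoint_def.1 hBA hb hbA, add_zero]
    exact hf

/-- An elementary group all of whose elements are divisible by every prime is zero. -/
lemma eq_zero_of_elementary_of_divisible (hG : IsElementary G) {x : G}
    (hx : ∀ p : ℕ, p.Prime → ∃ y, p • y = x) : x = 0 := by
  by_contra hx0
  obtain ⟨p, hp, hpx⟩ := Nat.exists_prime_and_dvd
    (fun h => hx0 (AddMonoid.addOrderOf_eq_one_iff.1 h) : addOrderOf x ≠ 1)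
  obtain ⟨y, rfl⟩ := hx p hp
  have hy := addOrderOf_nsmul_eq_zero y
  have hsq := hG y
  -- `p` divides the order of `p • y`. If it also divides the order of `y`, then `p ^ 2` does.
  by_cases hpy : p ∣ addOrderOf y
  · obtain ⟨k, hk⟩ := hpy
    have h0 : k • p • y = 0 := by rw [smul_smul, mul_comm, ← hk, hy]
    obtain ⟨j, rfl⟩ := hpx.trans (addOrderOf_dvd_of_nsmul_eq_zero h0)
    exact hp.prime.not_isUnit (hsq p ⟨j, by rw [hk]; ring⟩)
  · exact hpy (hpx.trans (addOrderOf_dvd_of_nsmul_eq_zero (by rw [smul_comm, hy, smul_zero])))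

lemma IsDivisible.le_frattini {C : AddSubgroup G} (hC : IsDivisible C) : C ≤ frattini G := by
  intro x hx p hp
  obtain ⟨y, hy⟩ := hC p hp.ne_zero ⟨x, hx⟩
  exact ⟨y, congrArg Subtype.val hy⟩

lemma IsDivisible.map {H : Type*} [AddCommGroup H] (f : G →+ H) {D : AddSubgroup G}
    (hD : IsDivisible D) : IsDivisible (D.map f) := by
  rintro n hn ⟨_, x, hx, rfl⟩
  obtain ⟨y, hy⟩ := hD n hn ⟨x, hx⟩
  refine ⟨⟨f y, y, y.2, rfl⟩, Subtype.ext ?_⟩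
  rw [AddSubgroup.coe_nsmul, ← map_nsmul]
  exact congrArg f (congrArg Subtype.val hy)

/-- If the elements of square-free order in a direct summand are divisible by every prime, then the
summand has no elementary direct summand. -/
lemma hasNoElementarySummand_of_le_frattini {A D : AddSubgroup G} (hAD : IsCompl A D)
    (hA : A ⊓ elementaryPart G ≤ frattini G) : HasNoElementarySummand A := by
  rintro E ⟨F, hEF⟩ hE
  refine eq_bot_iff.2 fun x hx => ?_
  suffices h : (⟨x, hx⟩ : E) = 0 by simpa using congrArg Subtype.val h
  refine eq_zero_of_elementary_of_divisible hE fun p hp => ?_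
  have hxS : (x : G) ∈ elementaryPart G := by
    have := hE ⟨x, hx⟩
    rwa [← AddSubgroup.addOrderOf_coe, ← AddSubgroup.addOrderOf_coe] at this
  -- Divisibility by `p` in `G` descends to `A` and then to `E` by projecting the quotient `g` onto
  -- the summands.
  obtain ⟨g, hg⟩ := hA ⟨x.2, hxS⟩ p hp
  obtain ⟨a, ha, d, hd, rfl⟩ := AddSubgroup.mem_sup.1
    (show g ∈ A ⊔ D by rw [hAD.sup_eq_top]; trivial)
  obtain ⟨e, he, f, hf, hef⟩ := AddSubgroup.mem_sup.1
    (show (⟨a, ha⟩ : A) ∈ E ⊔ F by rw [hEF.sup_eq_top]; trivial)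
  have hpd : p • d = 0 := by
    refine AddSubgroup.disjoint_def.1 hAD.disjoint ?_ (nsmul_mem hd p)
    have : p • d = x - p • a := by rw [← hg, smul_add]; abel
    rw [this]
    exact sub_mem x.2 (nsmul_mem ha p)
  have hxa : x = p • e + p • f := by
    rw [← nsmul_add, hef]
    ext
    rw [← hg, smul_add, hpd, add_zero]
    rfl
  have hpf : p • f = 0 := by
    refine AddSubgroup.disjoint_def.1 hEF.disjoint ?_ (nsmul_mem hf p)
    have : p • f = x - p • e := by rw [hxa]; abel
    rw [this]
    exact sub_mem hx (nsmul_mem he p)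
  refine ⟨⟨e, he⟩, Subtype.ext ?_⟩
  rw [hpf, add_zero] at hxa
  exact hxa.symm

lemma finite_socle_primaryComponent {A : AddSubgroup G}
    {p : ℕ} [hp : Fact p.Prime] (hA : A ⊓ elementaryPart G ≤ frattini G)
    (hfin : {v : G | p • v = 0 ∧ ∃ x, p • x = v}.Finite) :
    {x : AddCommGroup.primaryComponent A p | p • x = 0}.Finite := by
  refine Set.Finite.of_injOn (f := fun x : AddCommGroup.primaryComponent A p => ((x : A) : G))
    (t := {v : G | p • v = 0 ∧ ∃ x, p • x = v}) (fun x hx => ?_)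
    (Subtype.val_injective.comp Subtype.val_injective).injOn hfin
  have h0 : p • ((x : A) : G) = 0 := congrArg (fun z : AddCommGroup.primaryComponent A p => ((z : A) : G)) hx
  exact ⟨h0, hA ⟨(x : A).2, mem_elementaryPart_of_prime hp.out h0⟩ p hp.out⟩

/-- A divisible subgroup of the `p`-component of `A` is contained in `C`, which meets `A` trivially;
so the component is reduced. -/
lemma finite_primaryComponent_of_reduced {A C : AddSubgroup G} (hC : IsDivisiblePart C)
    (hAC : Disjoint A C) {p : ℕ} [hp : Fact p.Prime]
    (h : {x : AddCommGroup.primaryComponent A p | p • x = 0}.Finite) :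
    Finite (AddCommGroup.primaryComponent A p) := by
  refine finite_of_reduced hp.out (fun x => x.2.imp fun k hk => Subtype.ext hk)
    (fun D hD => eq_bot_iff.2 fun x hx => ?_) h
  let f : AddCommGroup.primaryComponent A p →+ G :=
    A.subtype.comp (AddCommGroup.primaryComponent A p).subtype
  have hle : D.map f ≤ C := hC.2 (hD.map f)
  have h0 : f x = 0 := AddSubgroup.disjoint_def.1 hAC (x : A).2 (hle ⟨x, hx, rfl⟩)
  exact Subtype.ext (Subtype.ext h0)

theorem IsHereditarilyGenCoHopfian.exists_decomposition (h : IsHereditarilyGenCoHopfian G) :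
    ∃ A B C : AddSubgroup G,
      DirectSum.IsInternal ![A, B, C] ∧
      IsDivisiblePart C ∧
      (∀ (p : ℕ) [Fact p.Prime], HasFiniteRank (AddCommGroup.primaryComponent C p)) ∧
      IsElementary B ∧
      HasNoElementarySummand A ∧
      (∀ (p : ℕ) [Fact p.Prime], Finite (AddCommGroup.primaryComponent A p)) := by
  obtain ⟨B, A', hB, hBA, hΦ, hA'⟩ := exists_elementary_isCompl h.isAddTorsion
  obtain ⟨C, hC⟩ := exists_isDivisiblePart G
  obtain ⟨R, hCR⟩ := IsDivisible.isComplemented hC.1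
  have hCΦ : C ≤ frattini G := IsDivisible.le_frattini hC.1
  -- Since `C ≤ frattini G ≤ A'`, the modular law gives `A' = C ⊕ (A' ⊓ R)`; the third summand is
  -- therefore `A' ⊓ R`.
  have hA : (A' ⊓ R) ⊓ elementaryPart G ≤ frattini G :=
    (inf_le_inf_right _ inf_le_left).trans hA'
  have hAC : Disjoint (A' ⊓ R) C := hCR.disjoint.symm.mono_left inf_le_right
  have hexists : ∀ x, ∃ a ∈ A' ⊓ R, ∃ b ∈ B, ∃ c ∈ C, a + b + c = x := by
    intro x
    obtain ⟨b, hb, a', ha', rfl⟩ := AddSubgroup.mem_sup.1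
      (show x ∈ B ⊔ A' by rw [hBA.sup_eq_top]; trivial)
    obtain ⟨c, hc, r, hr, rfl⟩ := AddSubgroup.mem_sup.1
      (show a' ∈ C ⊔ R by rw [hCR.sup_eq_top]; trivial)
    refine ⟨r, ⟨?_, hr⟩, b, hb, c, hc, by abel⟩
    have := sub_mem ha' (hΦ (hCΦ hc))
    simpa using this
  have hindep : ∀ a ∈ A' ⊓ R, ∀ b ∈ B, ∀ c ∈ C, a + b + c = 0 → a = 0 ∧ b = 0 ∧ c = 0 := by
    intro a ha b hb c hc habc
    have hb0 : b = 0 := by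
      refine AddSubgroup.disjoint_def.1 hBA.disjoint hb ?_
      have : b = -(a + c) := by rw [eq_neg_iff_add_eq_zero, ← habc]; abel
      rw [this]
      exact neg_mem (add_mem ha.1 (hΦ (hCΦ hc)))
    rw [hb0, add_zero] at habc
    have ha0 : a = 0 := by
      refine AddSubgroup.disjoint_def.1 hAC ha ?_
      rw [eq_neg_of_add_eq_zero_left habc]
      exact neg_mem hc
    rw [ha0, zero_add] at habc
    exact ⟨ha0, hb0, habc⟩
  refine ⟨A' ⊓ R, B, C, (isInternal_fin_three_iff _).2 ⟨hindep, hexists⟩, hC, fun p hp => ?_,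
    IsElementary.of_le hB, ?_, fun p hp => ?_⟩
  · exact hasFiniteRank_of_finite_socle hp.out
      (fun x => x.2.imp fun k hk => Subtype.ext hk)
      (finite_socle_primaryComponent (inf_le_left.trans hCΦ) (h.finite_socle_inter_nsmul hp.out))
  · refine hasNoElementarySummand_of_le_frattini (D := B ⊔ C) ⟨?_, ?_⟩ hA
    · refine AddSubgroup.disjoint_def.2 fun {x} hx hxD => ?_
      obtain ⟨b, hb, c, hc, rfl⟩ := AddSubgroup.mem_sup.1 hxD
      have := hindep _ (neg_mem hx) b hb c hc (by abel)
      rw [this.2.1, this.2.2, add_zero]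
    · refine codisjoint_iff.2 (eq_top_iff.2 fun x _ => ?_)
      obtain ⟨a, ha, b, hb, c, hc, rfl⟩ := hexists x
      rw [add_assoc]
      exact AddSubgroup.add_mem_sup ha (AddSubgroup.add_mem_sup hb hc)
  · exact finite_primaryComponent_of_reduced hC hAC
      (finite_socle_primaryComponent hA (h.finite_socle_inter_nsmul hp.out))

theorem isHereditarilyGenCoHopfian_of_decomposition (htor : IsAddTorsion G) {A B C : AddSubgroup G}
    (hint : DirectSum.IsInternal ![A, B, C])
    (hC : ∀ (p : ℕ) [Fact p.Prime], HasFiniteRank (AddCommGroup.primaryComponent C p))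
    (hB : IsElementary B)
    (hA : ∀ (p : ℕ) [Fact p.Prime], Finite (AddCommGroup.primaryComponent A p)) :
    IsHereditarilyGenCoHopfian G := by
  intro H
  refine isGenCoHopfian_of_finite_socle (htor.addSubgroup H) fun p hp => ?_
  have := Fact.mk hp
  have := hA p
  have hCfin := finite_socle_of_hasFiniteRank hp
    ((htor.addSubgroup C).addSubgroup (AddCommGroup.primaryComponent C p)) (hC p)
  have hAfin := Set.toFinite (Set.univ : Set (AddCommGroup.primaryComponent A p))
  -- For `y = a + b + c` in the `p`-component, `p • b = 0`, so `p • y = p • a + p • c`. The first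
  -- term lies in the finite `p`-component of `A`; if `p • y` is in the socle, the second lies in
  -- the finite `p`-socle of `C`.
  have hfin := Set.Finite.image2 (fun (a : AddCommGroup.primaryComponent A p)
    (c : AddCommGroup.primaryComponent C p) => ((a : A) : G) + ((c : C) : G)) hAfin hCfin
  refine Set.Finite.of_injOn (f := Subtype.val) (fun x hx => ?_) Subtype.val_injective.injOn hfin
  obtain ⟨hx0, k, y, hky, hyx⟩ := hx
  have hx0' : p • (x : G) = 0 := congrArg Subtype.val hx0
  have hky' : p ^ k • (y : G) = 0 := congrArg Subtype.val hky
  have hyx' : p • (y : G) = x := congrArg Subtype.val hyx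
  obtain ⟨hindep, hexists⟩ := (isInternal_fin_three_iff _).1 hint
  obtain ⟨a, ha, b, hb, c, hc, habc⟩ := hexists y
  have hsplit : ∀ n : ℕ, n • (y : G) = 0 → n • a = 0 ∧ n • b = 0 ∧ n • c = 0 := fun n hn =>
    hindep _ (nsmul_mem ha n) _ (nsmul_mem hb n) _ (nsmul_mem hc n)
      (by rw [← smul_add, ← smul_add, habc, hn])
  obtain ⟨hak, hbk, hck⟩ := hsplit _ hky'
  have hpb : p • b = 0 := by
    refine prime_nsmul_eq_zero_of_squarefree ?_ hp hbk
    have := hB ⟨b, hb⟩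
    rwa [← AddSubgroup.addOrderOf_coe] at this
  have hppc : p • p • c = 0 := by
    rw [smul_smul]
    exact (hsplit (p * p) (by rw [mul_smul, hyx', hx0'])).2.2
  refine ⟨⟨⟨p • a, nsmul_mem ha p⟩, k, Subtype.ext ?_⟩, trivial,
    ⟨⟨p • c, nsmul_mem hc p⟩, k, Subtype.ext ?_⟩, Subtype.ext (Subtype.ext hppc), ?_⟩
  · change p ^ k • p • a = 0
    rw [smul_comm, hak, smul_zero]
  · change p ^ k • p • c = 0
    rw [smul_comm, hck, smul_zero]
  · change p • a + p • c = x
    rw [← hyx', ← habc, smul_add, smul_add, hpb, add_zero]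

end Structure

end HerGenCoHopf

theorem proposition2p47 (G : Type*) [AddCommGroup G] :
    HerGenCoHopf.IsHereditarilyGenCoHopfian G ↔
      IsAddTorsion G ∧
        ∃ A B C : AddSubgroup G,
          DirectSum.IsInternal ![A, B, C] ∧
          HerGenCoHopf.IsDivisiblePart C ∧
          (∀ (p : ℕ) [Fact p.Prime],
            HerGenCoHopf.HasFiniteRank (AddCommGroup.primaryComponent C p)) ∧
          HerGenCoHopf.IsElementary B ∧
          HerGenCoHopf.HasNoElementarySummand A ∧
          (∀ (p : ℕ) [Fact p.Prime], Finite (AddCommGroup.primaryComponent A p)) := by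
  constructor
  · intro h
    exact ⟨h.isAddTorsion, h.exists_decomposition⟩
  · rintro ⟨htor, A, B, C, hint, -, hC, hB, -, hA⟩
    exact HerGenCoHopf.isHereditarilyGenCoHopfian_of_decomposition htor hint hC hB hA
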